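/- (Joint quasi-convexity of the sandwiched Rényi relative entropy.) Let $\mathcal{H}$ be a finite-dimensional complex Hilbert space (identified with $\mathbb{C}^n$, so that operators are $n\times n$ complex matrices). For $\alpha\in(1,\infty)$ and positive semidefinite operators $A,B$ on $\mathcal{H}$ let $$\widetilde{Q}_\alpha(A\|B)=\begin{cases}\operatorname{Tr}\left\{\left(B^{\frac{1-\alpha}{2\alpha}}\,A\,B^{\frac{1-\alpha}{2\alpha}}\right)^{\alpha}\right\} & \text{if } \operatorname{supp}(A)\subseteq\operatorname{supp}(B),\\ \infty & \text{otherwise,}\end{cases}\qquad \widetilde{D}_\alpha(A\|B)=\frac{1}{\alpha-1}\log_2\widetilde{Q}_\alpha(A\|B)\in[-\infty,\infty],$$ where $\operatorname{supp}$ denotes the orthogonal complement of the kernel, negative powers of $B$ are taken on the support of $B$ (and are zero on its kernel), $\log_2 0=-\infty$ and $\log_2\infty=\infty$. Let $\alpha\in(1,2]$, let $p$ be a probability distribution on a finite non-empty set $\mathcal{X}$, and let $(A_x)_{x\in\mathcal{X}}$ and $(B_x)_{x\in\mathcal{X}}$ be families of positive semidefinite operators on $\mathcal{H}$. Put $A=\sum_{x}p(x)A_x$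 and $B=\sum_{x}p(x)B_x$. Then $$\widetilde{D}_\alpha(A\|B)\le\max_{x\in\mathcal{X}}\widetilde{D}_\alpha(A_x\|B_x).$$ -/

import Mathlib

open scoped ENNReal ComplexOrder

noncomputable section

namespace SandwichedRenyi

variable {n : Type*} [Fintype n] [DecidableEq n]

/-- The support of an operator on `ℂⁿ`: the orthogonal complement of its kernel. -/
def supp (A : Matrix n n ℂ) : Submodule ℂ (EuclideanSpace ℂ n) :=
  (LinearMap.ker (Matrix.toEuclideanLin A))ᗮ

/-- The real power `A ^ s` of a positive semidefinite matrix, by functional calculus. Since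
`(0 : ℝ) ^ s = 0` for `s ≠ 0`, for a negative exponent the power (the inverse) is taken on the
support of `A`, and `A ^ s` vanishes on the kernel of `A`. -/
def psdPow (A : Matrix n n ℂ) (s : ℝ) : Matrix n n ℂ :=
  cfc (fun t : ℝ => t ^ s) A

open Classical in
/-- The sandwiched quasi-relative entropy `Q̃_α(A‖B)` of positive semidefinite matrices `A`, `B`,
for `α > 1`, with values in `[0, ∞]`:
`Tr ((B ^ ((1-α)/(2α)) * A * B ^ ((1-α)/(2α))) ^ α)` if `supp A ⊆ supp B`, and `∞` otherwise.
(The trace is that of a positive semidefinite matrix, hence a nonnegative real number.) -/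
def Qtilde (α : ℝ) (A B : Matrix n n ℂ) : ℝ≥0∞ :=
  if supp A ≤ supp B then
    ENNReal.ofReal
      (psdPow (psdPow B ((1 - α) / (2 * α)) * A * psdPow B ((1 - α) / (2 * α))) α).trace.re
  else ⊤

/-- The binary logarithm `[0, ∞] → [-∞, ∞]`, with `log₂ 0 = -∞` and `log₂ ∞ = ∞`. -/
def log2 (x : ℝ≥0∞) : EReal :=
  ENNReal.log x / ((Real.log 2 : ℝ) : EReal)

/-- The sandwiched Rényi relative entropy `D̃_α(A‖B) = (1/(α-1)) log₂ Q̃_α(A‖B)`, for `α > 1`,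
with values in `[-∞, ∞]`. -/
def Dtilde (α : ℝ) (A B : Matrix n n ℂ) : EReal :=
  ((1 / (α - 1) : ℝ) : EReal) * log2 (Qtilde α A B)

end SandwichedRenyi

end

/-! Quasi-convexity follows from joint convexity of `Qtilde`, proved by complex interpolation. Let X
and Y_x be the sandwiches of (A, B) and (A_x, B_x), q = Tr X^α and S = ∑ p(x) Tr Y_x^α. Consider
F(z) = ∑ p(x) Tr[X^{αz} B^{-z/2} B_x^{z/2} Y_x^{α(1-z)} B_x^{z/2} B^{-z/2}]. Imaginary powers are
Frobenius contractions, so |F| ≤ S on re z = 0. On re z = 1, ∑ p(x) B_x = B gives |F| ≤ q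
(`sum_mul_frobSq_mul_psdCpow_half`). At θ = (α-1)/α the inner factors rebuild A_x
(`psdCpow_mul_sandwich_mul`), whence F(θ) = Tr X^{α-1} X = q. The three lines theorem yields q ≤
S^{1/α} q^{(α-1)/α}, i.e. q ≤ S. -/

namespace SandwichedRenyi

open Matrix Complex Complex.HadamardThreeLines

variable {n : Type*} [Fintype n]

/-! ### Frobenius norm estimates -/

/-- The square of the Frobenius norm. -/
noncomputable def frobSq (M : Matrix n n ℂ) : ℝ := ∑ i, ∑ j, ‖M i j‖ ^ 2

lemma frobSq_conjTranspose (M : Matrix n n ℂ) : frobSq Mᴴ = frobSq M := by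
  unfold frobSq
  rw [Finset.sum_comm]
  simp [conjTranspose_apply]

lemma ofReal_frobSq (M : Matrix n n ℂ) : (frobSq M : ℂ) = (M * Mᴴ).trace := by
  simp only [frobSq, Matrix.trace, Matrix.diag, Matrix.mul_apply, conjTranspose_apply]
  push_cast
  refine Finset.sum_congr rfl fun i _ => Finset.sum_congr rfl fun j _ => ?_
  exact (Complex.mul_conj' _).symm

/-- Entrywise AM-GM. This additive form, unlike Cauchy–Schwarz, can be averaged over x term by term.
-/
lemma norm_trace_mul_le (L R : Matrix n n ℂ) :
    ‖(L * R).trace‖ ≤ (frobSq L + frobSq R) / 2 := by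
  have h : frobSq R = ∑ i, ∑ j, ‖R j i‖ ^ 2 := Finset.sum_comm
  rw [h, frobSq, ← Finset.sum_add_distrib, Finset.sum_div]
  simp only [Matrix.trace, Matrix.diag, Matrix.mul_apply]
  refine (norm_sum_le _ _).trans (Finset.sum_le_sum fun i _ => ?_)
  rw [← Finset.sum_add_distrib, Finset.sum_div]
  refine (norm_sum_le _ _).trans (Finset.sum_le_sum fun j _ => ?_)
  rw [norm_mul]
  nlinarith [sq_nonneg (‖L i j‖ - ‖R j i‖)]

lemma frobSq_mul_of_conjTranspose_mul_self [DecidableEq n] (U M : Matrix n n ℂ) (hU : Uᴴ * U = 1) :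
    frobSq (U * M) = frobSq M := by
  have h : ((frobSq (U * M) : ℝ) : ℂ) = frobSq M := by
    rw [ofReal_frobSq, ofReal_frobSq, conjTranspose_mul, Matrix.trace_mul_comm, Matrix.mul_assoc,
      ← Matrix.mul_assoc Uᴴ, hU, Matrix.one_mul, Matrix.trace_mul_comm]
  exact_mod_cast h

lemma frobSq_diagonal_mul_le [DecidableEq n] (d : n → ℂ) (hd : ∀ i, ‖d i‖ ≤ 1)
    (M : Matrix n n ℂ) : frobSq (diagonal d * M) ≤ frobSq M := by
  refine Finset.sum_le_sum fun i _ => Finset.sum_le_sum fun j _ => ?_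
  rw [diagonal_mul, norm_mul, mul_pow]
  exact mul_le_of_le_one_left (by positivity) (pow_le_one₀ (norm_nonneg _) (hd i))

/-! ### Weighted sums of positive semidefinite matrices -/

lemma posSemidef_sum_smul {m ι : Type*} [Fintype ι] {p : ι → ℝ} (hp : ∀ x, 0 ≤ p x) {A : ι → Matrix m m ℂ}
    (hA : ∀ x, (A x).PosSemidef) : (∑ x, p x • A x).PosSemidef :=
  posSemidef_sum _ fun x _ => (hA x).smul (hp x)

/-- Nonnegative quadratic forms summing to zero at v all vanish there, so v lies in the kernel of
each p(x) B_x. -/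
lemma sum_smul_ker {ι : Type*} [Fintype ι] {p : ι → ℝ} (hp : ∀ x, 0 ≤ p x) {A B : ι → Matrix n n ℂ}
    (hB : ∀ x, (B x).PosSemidef)
    (h : ∀ x v, B x *ᵥ v = 0 → A x *ᵥ v = 0) (v : n → ℂ)
    (hv : (∑ x, p x • B x) *ᵥ v = 0) : (∑ x, p x • A x) *ᵥ v = 0 := by
  have h0 : ∀ x ∈ Finset.univ, 0 ≤ star v ⬝ᵥ (p x • B x) *ᵥ v := fun x _ =>
    ((hB x).smul (hp x)).dotProduct_mulVec_nonneg v
  have h1 : ∑ x, star v ⬝ᵥ (p x • B x) *ᵥ v = 0 := by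
    rw [← dotProduct_sum, ← Matrix.sum_mulVec, hv, dotProduct_zero]
  rw [Finset.sum_eq_zero_iff_of_nonneg h0] at h1
  rw [Matrix.sum_mulVec]
  refine Finset.sum_eq_zero fun x hx => ?_
  have h2 := (((hB x).smul (hp x)).dotProduct_mulVec_zero_iff v).1 (h1 x hx)
  rw [Matrix.smul_mulVec] at h2 ⊢
  rcases smul_eq_zero.1 h2 with h3 | h3
  · rw [h3, zero_smul]
  · rw [h x v h3, smul_zero]

/-! ### Complex powers on the support -/

section FunctionalCalculus

variable [DecidableEq n] {A : Matrix n n ℂ}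

/-- Functional calculus of a Hermitian matrix for complex-valued functions. -/
noncomputable def spectralFun (hA : A.IsHermitian) (f : ℝ → ℂ) : Matrix n n ℂ :=
  (hA.eigenvectorUnitary : Matrix n n ℂ) * diagonal (fun i => f (hA.eigenvalues i)) *
    (hA.eigenvectorUnitary : Matrix n n ℂ)ᴴ

lemma eigenvectorUnitary_conjTranspose_mul_self (hA : A.IsHermitian) :
    (hA.eigenvectorUnitary : Matrix n n ℂ)ᴴ * hA.eigenvectorUnitary = 1 :=
  Unitary.coe_star_mul_self hA.eigenvectorUnitary

lemma eigenvectorUnitary_mul_conjTranspose_self (hA : A.IsHermitian) :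
    (hA.eigenvectorUnitary : Matrix n n ℂ) * (hA.eigenvectorUnitary : Matrix n n ℂ)ᴴ = 1 :=
  Unitary.coe_mul_star_self hA.eigenvectorUnitary

lemma spectralFun_mul (hA : A.IsHermitian) (f g : ℝ → ℂ) :
    spectralFun hA f * spectralFun hA g = spectralFun hA (fun t => f t * g t) := by
  unfold spectralFun
  rw [← diagonal_mul_diagonal]
  simp only [Matrix.mul_assoc]
  rw [← Matrix.mul_assoc _ᴴ, eigenvectorUnitary_conjTranspose_mul_self, Matrix.one_mul]

lemma spectralFun_conjTranspose (hA : A.IsHermitian) (f : ℝ → ℂ) :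
    (spectralFun hA f)ᴴ = spectralFun hA (fun t => star (f t)) := by
  unfold spectralFun
  rw [conjTranspose_mul, conjTranspose_mul, conjTranspose_conjTranspose, diagonal_conjTranspose,
    Matrix.mul_assoc]
  rfl

lemma spectralFun_congr (hA : A.IsHermitian) {f g : ℝ → ℂ}
    (h : ∀ i, f (hA.eigenvalues i) = g (hA.eigenvalues i)) :
    spectralFun hA f = spectralFun hA g := by
  unfold spectralFun
  rw [funext h]

lemma spectralFun_ofReal (hA : A.IsHermitian) : spectralFun hA (fun t => (t : ℂ)) = A :=
  hA.spectral_theorem.symm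

lemma cfc_eq_spectralFun (hA : A.IsHermitian) (f : ℝ → ℝ) :
    cfc f A = spectralFun hA (fun t => (f t : ℂ)) :=
  hA.cfc_eq f

lemma frobSq_spectralFun_mul_le (hA : A.IsHermitian) (f : ℝ → ℂ)
    (hf : ∀ i, ‖f (hA.eigenvalues i)‖ ≤ 1) (M : Matrix n n ℂ) :
    frobSq (spectralFun hA f * M) ≤ frobSq M := by
  unfold spectralFun
  rw [Matrix.mul_assoc, Matrix.mul_assoc,
    frobSq_mul_of_conjTranspose_mul_self _ _ (eigenvectorUnitary_conjTranspose_mul_self hA)]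
  refine (frobSq_diagonal_mul_le _ hf _).trans_eq (frobSq_mul_of_conjTranspose_mul_self _ _ ?_)
  rw [conjTranspose_conjTranspose, eigenvectorUnitary_mul_conjTranspose_self]

/-- The complex power of a real number, with `0 ^ z = 0` for every `z`. -/
noncomputable def suppCpow (z : ℂ) (t : ℝ) : ℂ := if t = 0 then 0 else (t : ℂ) ^ z

lemma norm_suppCpow_le_one {t : ℝ} (ht : 0 ≤ t) {z : ℂ} (hz : z.re = 0) :
    ‖suppCpow z t‖ ≤ 1 := by
  unfold suppCpow
  split_ifs with h
  · simp
  · rw [norm_cpow_eq_rpow_re_of_pos (lt_of_le_of_ne ht (Ne.symm h)), hz, Real.rpow_zero]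

/-- The complex power of a positive semidefinite matrix, taken on its support. -/
noncomputable def psdCpow (hA : A.PosSemidef) (z : ℂ) : Matrix n n ℂ := spectralFun hA.1 (suppCpow z)

variable (hA : A.PosSemidef)

/-- No invertibility is needed: every power, even the zeroth, kills the kernel. -/
lemma psdCpow_mul (z w : ℂ) : psdCpow hA z * psdCpow hA w = psdCpow hA (z + w) := by
  unfold psdCpow
  rw [spectralFun_mul]
  congr 1
  funext t
  unfold suppCpow
  split_ifs with h
  · simp
  · rw [cpow_add _ _ (by exact_mod_cast h)]

lemma psdCpow_mul_assoc (z w : ℂ) (M : Matrix n n ℂ) :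
    psdCpow hA z * (psdCpow hA w * M) = psdCpow hA (z + w) * M := by
  rw [← Matrix.mul_assoc, psdCpow_mul]

lemma psdCpow_conjTranspose (z : ℂ) : (psdCpow hA z)ᴴ = psdCpow hA (star z) := by
  unfold psdCpow
  rw [spectralFun_conjTranspose]
  refine spectralFun_congr _ fun i => ?_
  have h0 := hA.eigenvalues_nonneg i
  unfold suppCpow
  split_ifs with h
  · simp
  · have harg : ((hA.1.eigenvalues i : ℝ) : ℂ).arg ≠ Real.pi := by
      rw [arg_ofReal_of_nonneg h0]
      exact Real.pi_ne_zero.symm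
    have := cpow_conj ((hA.1.eigenvalues i : ℝ) : ℂ) z harg
    rw [conj_ofReal] at this
    exact this.symm

lemma psdCpow_one : psdCpow hA 1 = A := by
  conv_rhs => rw [← spectralFun_ofReal hA.1]
  refine spectralFun_congr _ fun i => ?_
  unfold suppCpow
  split_ifs with h <;> simp [h]

lemma psdPow_eq_psdCpow {s : ℝ} (hs : s ≠ 0) : psdPow A s = psdCpow hA s := by
  unfold psdPow
  rw [cfc_eq_spectralFun hA.1]
  refine spectralFun_congr _ fun i => ?_
  unfold suppCpow
  split_ifs with h
  · simp [h, Real.zero_rpow hs]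
  · exact ofReal_cpow (hA.eigenvalues_nonneg i) s

lemma frobSq_psdCpow_mul_le {z : ℂ} (hz : z.re = 0) (M : Matrix n n ℂ) :
    frobSq (psdCpow hA z * M) ≤ frobSq M :=
  frobSq_spectralFun_mul_le _ _ (fun i => norm_suppCpow_le_one (hA.eigenvalues_nonneg i) hz) M

lemma frobSq_mul_psdCpow_le {z : ℂ} (hz : z.re = 0) (M : Matrix n n ℂ) :
    frobSq (M * psdCpow hA z) ≤ frobSq M := by
  rw [← frobSq_conjTranspose, conjTranspose_mul, psdCpow_conjTranspose]
  exact (frobSq_psdCpow_mul_le hA (by simpa using hz) _).trans_eq (frobSq_conjTranspose M)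

lemma ofReal_frobSq_mul_psdCpow_half (M : Matrix n n ℂ) :
    (frobSq (M * psdCpow hA (1 / 2)) : ℂ) = (M * A * Mᴴ).trace := by
  rw [ofReal_frobSq, conjTranspose_mul, psdCpow_conjTranspose, Matrix.mul_assoc,
    psdCpow_mul_assoc, ← Matrix.mul_assoc]
  have : (1 / 2 + star (1 / 2) : ℂ) = 1 := by
    simp only [star_def, map_div₀, map_one, map_ofNat]
    norm_num
  rw [this, psdCpow_one]

lemma frobSq_psdCpow_half_mul (M : Matrix n n ℂ) :
    frobSq (psdCpow hA (1 / 2) * M) = frobSq (Mᴴ * psdCpow hA (1 / 2)) := by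
  rw [← frobSq_conjTranspose, conjTranspose_mul, psdCpow_conjTranspose]
  simp

lemma ofReal_frobSq_psdCpow (s : ℝ) :
    (frobSq (psdCpow hA ((s / 2 : ℝ) : ℂ)) : ℂ) = (psdCpow hA s).trace := by
  rw [ofReal_frobSq, psdCpow_conjTranspose, psdCpow_mul, star_def, conj_ofReal, ← ofReal_add,
    add_halves]

/-- The zeroth power is the support projection; the columns of its complement lie in ker A, hence in
ker C. -/
lemma mul_psdCpow_zero {C : Matrix n n ℂ} (h : ∀ v : n → ℂ, A *ᵥ v = 0 → C *ᵥ v = 0) :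
    C * psdCpow hA 0 = C := by
  have h1 : A * (1 - psdCpow hA 0) = 0 := by
    conv_lhs => enter [1]; rw [← psdCpow_one hA]
    rw [Matrix.mul_sub, psdCpow_mul, Matrix.mul_one, add_zero, sub_self]
  have h2 : C * (1 - psdCpow hA 0) = 0 := by
    ext i j
    have h3 : A *ᵥ (fun k => (1 - psdCpow hA 0) k j) = 0 := by
      ext i
      exact congr_fun (congr_fun h1 i) j
    exact congr_fun (h _ h3) i
  rw [Matrix.mul_sub, Matrix.mul_one, sub_eq_zero] at h2
  exact h2.symm

end FunctionalCalculus

/-! ### The three lines theorem for matrix functions -/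

section Interpolation

/-- Entire functions that are bounded on the strip `0 ≤ re z ≤ 1`. -/
def BoundedOnStrip (f : ℂ → ℂ) : Prop :=
  Differentiable ℂ f ∧ ∃ C, ∀ z ∈ verticalClosedStrip 0 1, ‖f z‖ ≤ C

lemma BoundedOnStrip.const (c : ℂ) : BoundedOnStrip fun _ => c :=
  ⟨differentiable_const c, ‖c‖, fun _ _ => le_rfl⟩

lemma BoundedOnStrip.mul {f g : ℂ → ℂ} (hf : BoundedOnStrip f) (hg : BoundedOnStrip g) :
    BoundedOnStrip fun z => f z * g z := by
  obtain ⟨hf, C, hC⟩ := hf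
  obtain ⟨hg, D, hD⟩ := hg
  refine ⟨hf.mul hg, C * D, fun z hz => ?_⟩
  rw [norm_mul]
  exact mul_le_mul (hC z hz) (hD z hz) (norm_nonneg _) ((norm_nonneg _).trans (hC z hz))

lemma BoundedOnStrip.sum {κ : Type*} {s : Finset κ} {f : κ → ℂ → ℂ}
    (hf : ∀ k, BoundedOnStrip (f k)) : BoundedOnStrip fun z => ∑ k ∈ s, f k z := by
  choose hd C hC using hf
  refine ⟨Differentiable.fun_sum fun k _ => hd k, ∑ k ∈ s, C k, fun z hz => ?_⟩
  exact (norm_sum_le _ _).trans (Finset.sum_le_sum fun k _ => hC k z hz)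

lemma BoundedOnStrip.suppCpow {t : ℝ} (ht : 0 ≤ t) (a b : ℝ) :
    BoundedOnStrip fun z => suppCpow (a * z + b) t := by
  unfold SandwichedRenyi.suppCpow
  split_ifs with h
  · exact BoundedOnStrip.const 0
  · have htc : (t : ℂ) ≠ 0 := by exact_mod_cast h
    have ht' : 0 < t := lt_of_le_of_ne ht (Ne.symm h)
    refine ⟨fun z => DifferentiableAt.const_cpow (by fun_prop) (Or.inl htc),
      Real.exp (|Real.log t| * (|a| + |b|)), fun z hz => ?_⟩
    rw [norm_cpow_eq_rpow_re_of_pos ht', Real.rpow_def_of_pos ht']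
    refine Real.exp_le_exp.2 ((le_abs_self _).trans ?_)
    rw [abs_mul]
    refine mul_le_mul_of_nonneg_left ?_ (abs_nonneg _)
    have hz' : 0 ≤ z.re ∧ z.re ≤ 1 := hz
    have hre : (a * z + b : ℂ).re = a * z.re + b := by simp
    rw [hre]
    refine (abs_add_le _ _).trans (add_le_add_left ?_ _)
    rw [abs_mul, abs_of_nonneg hz'.1]
    exact mul_le_of_le_one_right (abs_nonneg _) hz'.2

/-- Matrix functions whose entries are entire and bounded on the strip `0 ≤ re z ≤ 1`. -/
def MatrixBoundedOnStrip (G : ℂ → Matrix n n ℂ) : Prop :=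
  ∀ i j, BoundedOnStrip fun z => G z i j

lemma MatrixBoundedOnStrip.const {m : Type*} (M : Matrix m m ℂ) : MatrixBoundedOnStrip fun _ => M :=
  fun i j => BoundedOnStrip.const (M i j)

lemma MatrixBoundedOnStrip.mul {G H : ℂ → Matrix n n ℂ} (hG : MatrixBoundedOnStrip G)
    (hH : MatrixBoundedOnStrip H) : MatrixBoundedOnStrip fun z => G z * H z := by
  intro i j
  simp only [Matrix.mul_apply]
  exact BoundedOnStrip.sum fun k => (hG i k).mul (hH k j)

lemma MatrixBoundedOnStrip.trace {G : ℂ → Matrix n n ℂ} (hG : MatrixBoundedOnStrip G) :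
    BoundedOnStrip fun z => (G z).trace :=
  BoundedOnStrip.sum fun k => hG k k

lemma MatrixBoundedOnStrip.psdCpow [DecidableEq n] {A : Matrix n n ℂ} (hA : A.PosSemidef)
    (a b : ℝ) {w : ℂ → ℂ} (hw : ∀ z, w z = a * z + b) :
    MatrixBoundedOnStrip fun z => psdCpow hA (w z) := by
  obtain rfl : w = fun z : ℂ => (a : ℂ) * z + b := funext hw
  have hD : MatrixBoundedOnStrip fun z : ℂ => diagonal fun i =>
      SandwichedRenyi.suppCpow ((a : ℂ) * z + b) (hA.1.eigenvalues i) := by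
    intro i j
    by_cases h : i = j
    · subst h
      simpa only [diagonal_apply_eq] using BoundedOnStrip.suppCpow (hA.eigenvalues_nonneg i) a b
    · simpa only [diagonal_apply_ne _ h] using BoundedOnStrip.const 0
  exact ((MatrixBoundedOnStrip.const (hA.1.eigenvectorUnitary : Matrix n n ℂ)).mul hD).mul
    (MatrixBoundedOnStrip.const (hA.1.eigenvectorUnitary : Matrix n n ℂ)ᴴ)

lemma BoundedOnStrip.norm_le_interp {f : ℂ → ℂ} (hf : BoundedOnStrip f) {a b θ : ℝ}
    (h0 : 0 ≤ θ) (h1 : θ ≤ 1) (ha : ∀ z : ℂ, z.re = 0 → ‖f z‖ ≤ a)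
    (hb : ∀ z : ℂ, z.re = 1 → ‖f z‖ ≤ b) : ‖f θ‖ ≤ a ^ (1 - θ) * b ^ θ := by
  obtain ⟨hd, C, hC⟩ := hf
  have h := norm_le_interp_of_mem_verticalClosedStrip₀₁' f (z := (θ : ℂ)) (a := a) (b := b)
    ⟨by simpa using h0, by simpa using h1⟩ hd.diffContOnCl
    ⟨C, by rintro _ ⟨z, hz, rfl⟩; exact hC z hz⟩ (fun z hz => ha z hz) (fun z hz => hb z hz)
  simpa using h

end Interpolation

/-! ### Joint convexity and quasi-convexity -/

section JointConvexity

variable [DecidableEq n]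

/-- The operator `B ^ ((1-α)/(2α)) * A * B ^ ((1-α)/(2α))`. -/
noncomputable def sandwich (α : ℝ) (A B : Matrix n n ℂ) : Matrix n n ℂ :=
  psdPow B ((1 - α) / (2 * α)) * A * psdPow B ((1 - α) / (2 * α))

lemma sandwich_posSemidef (α : ℝ) {A B : Matrix n n ℂ} (hA : A.PosSemidef) :
    (sandwich α A B).PosSemidef := by
  have h : (psdPow B ((1 - α) / (2 * α)))ᴴ = psdPow B ((1 - α) / (2 * α)) :=
    cfc_predicate (R := ℝ) (p := IsSelfAdjoint) _ B
  have := hA.mul_mul_conjTranspose_same (psdPow B ((1 - α) / (2 * α)))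
  rwa [h] at this

lemma psdPow_trace_re {A : Matrix n n ℂ} (hA : A.PosSemidef) {s : ℝ} (hs : s ≠ 0) :
    (psdPow A s).trace.re = frobSq (psdCpow hA ((s / 2 : ℝ) : ℂ)) := by
  rw [psdPow_eq_psdCpow hA hs, ← ofReal_frobSq_psdCpow, ofReal_re]

variable {ι : Type*} [Fintype ι]

/-- The quantity is Tr(M B Mᴴ), which is linear in B. -/
lemma sum_mul_frobSq_mul_psdCpow_half {p : ι → ℝ} {B : ι → Matrix n n ℂ}
    (hB : ∀ x, (B x).PosSemidef) (hBs : (∑ x, p x • B x).PosSemidef) (M : Matrix n n ℂ) :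
    ∑ x, p x * frobSq (M * psdCpow (hB x) (1 / 2)) = frobSq (M * psdCpow hBs (1 / 2)) := by
  have h : ((∑ x, p x * frobSq (M * psdCpow (hB x) (1 / 2)) : ℝ) : ℂ) =
      frobSq (M * psdCpow hBs (1 / 2)) := by
    push_cast
    simp only [ofReal_frobSq_mul_psdCpow_half, Matrix.mul_sum, Matrix.sum_mul, Matrix.trace_sum,
      Matrix.mul_smul, Matrix.smul_mul, Matrix.trace_smul, real_smul]
  exact_mod_cast h

lemma supp_le_iff {A B : Matrix n n ℂ} :
    supp A ≤ supp B ↔ ∀ v : n → ℂ, B *ᵥ v = 0 → A *ᵥ v = 0 := by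
  unfold supp
  rw [Submodule.orthogonal_le_orthogonal_iff]
  constructor
  · intro h v hv
    have h1 : WithLp.toLp 2 v ∈ LinearMap.ker (Matrix.toEuclideanLin B) := by
      simp [Matrix.toLpLin_toLp, hv]
    simpa [Matrix.toLpLin_toLp] using h h1
  · intro h v hv
    rw [LinearMap.mem_ker, Matrix.toLpLin_apply, WithLp.toLp_eq_zero] at hv ⊢
    exact h _ hv

/-- The sandwich by powers of `B` can be undone on the support of `B`. -/
lemma psdCpow_mul_sandwich_mul {α : ℝ} (hα : 1 < α) {A B : Matrix n n ℂ} (hA : A.PosSemidef)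
    (hB : B.PosSemidef) (h : ∀ v : n → ℂ, B *ᵥ v = 0 → A *ᵥ v = 0) {s : ℂ}
    (hs : s + ((1 - α) / (2 * α) : ℝ) = 0) :
    psdCpow hB s * sandwich α A B * psdCpow hB s = A := by
  have hne : (1 - α) / (2 * α) ≠ 0 := div_ne_zero (by linarith) (by linarith)
  have h1 := mul_psdCpow_zero hB h
  have h2 : psdCpow hB 0 * A = A := by
    have := congrArg conjTranspose h1
    rwa [conjTranspose_mul, psdCpow_conjTranspose, star_zero, hA.1.eq] at this
  rw [sandwich, psdPow_eq_psdCpow hB hne]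
  simp only [Matrix.mul_assoc, psdCpow_mul_assoc, psdCpow_mul]
  rw [hs, add_comm, hs, h1, h2]

/-- Joint convexity of the sandwiched quasi-relative entropy. -/
theorem trace_sandwich_sum_le {α : ℝ} (hα : 1 < α) {p : ι → ℝ} (hp : ∀ x, 0 ≤ p x)
    {A B : ι → Matrix n n ℂ} (hA : ∀ x, (A x).PosSemidef) (hB : ∀ x, (B x).PosSemidef)
    (hker : ∀ x v, B x *ᵥ v = 0 → A x *ᵥ v = 0) :
    (psdPow (sandwich α (∑ x, p x • A x) (∑ x, p x • B x)) α).trace.re ≤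
      ∑ x, p x * (psdPow (sandwich α (A x) (B x)) α).trace.re := by
  have hα0 : α ≠ 0 := by linarith
  have hαc : (α : ℂ) ≠ 0 := by exact_mod_cast hα0
  have hAs := posSemidef_sum_smul hp hA
  have hBs := posSemidef_sum_smul hp hB
  have hX := sandwich_posSemidef α (B := ∑ x, p x • B x) hAs
  have hY := fun x => sandwich_posSemidef α (B := B x) (hA x)
  rw [psdPow_trace_re hX hα0]
  simp only [psdPow_trace_re (hY _) hα0]
  set q := frobSq (psdCpow hX ((α / 2 : ℝ) : ℂ)) with hq
  set S := ∑ x, p x * frobSq (psdCpow (hY x) ((α / 2 : ℝ) : ℂ)) with hS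
  have hfrob : ∀ M : Matrix n n ℂ, 0 ≤ frobSq M := fun M =>
    Finset.sum_nonneg fun i _ => Finset.sum_nonneg fun j _ => by positivity
  have hq0 : 0 ≤ q := hfrob _
  have hS0 : 0 ≤ S := Finset.sum_nonneg fun x _ => mul_nonneg (hp x) (hfrob _)
  let T : ι → ℂ → Matrix n n ℂ := fun x z =>
    psdCpow hX (α * z) * (psdCpow hBs (-z / 2) * psdCpow (hB x) (z / 2) *
      psdCpow (hY x) (α * (1 - z)) * psdCpow (hB x) (z / 2) * psdCpow hBs (-z / 2))
  have hF : BoundedOnStrip fun z => ∑ x, (p x : ℂ) * (T x z).trace := by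
    refine BoundedOnStrip.sum fun x => (BoundedOnStrip.const _).mul
      (MatrixBoundedOnStrip.trace ?_)
    have hb1 := MatrixBoundedOnStrip.psdCpow hBs (-1 / 2) 0 (w := fun z => -z / 2)
      (fun z => by push_cast; ring)
    have hb2 := MatrixBoundedOnStrip.psdCpow (hB x) (1 / 2) 0 (w := fun z => z / 2)
      (fun z => by push_cast; ring)
    exact (MatrixBoundedOnStrip.psdCpow hX α 0 (fun z => by push_cast; ring)).mul
      ((((hb1.mul hb2).mul (MatrixBoundedOnStrip.psdCpow (hY x) (-α) α
        (fun z => by push_cast; ring))).mul hb2).mul hb1)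
  have hnorm : ∀ z, ‖∑ x, (p x : ℂ) * (T x z).trace‖ ≤ ∑ x, p x * ‖(T x z).trace‖ := fun z =>
    (norm_sum_le _ _).trans_eq <| Finset.sum_congr rfl fun x _ => by
      rw [norm_mul, norm_real, Real.norm_of_nonneg (hp x)]
  have h0 : ∀ z : ℂ, z.re = 0 → ‖∑ x, (p x : ℂ) * (T x z).trace‖ ≤ S := by
    intro z hz
    refine (hnorm z).trans (Finset.sum_le_sum fun x _ => mul_le_mul_of_nonneg_left ?_ (hp x))
    have hz2 : (z / 2).re = 0 := by simp [hz]
    have hz3 : (-z / 2).re = 0 := by simp [hz]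
    -- Split Y_x^{α(1-z)} as Y_x^{α/2} Y_x^{-αz} Y_x^{α/2}; all powers other than the Y_x^{α/2} are
    -- imaginary.
    have hT : T x z = (psdCpow hX (α * z) * (psdCpow hBs (-z / 2) * (psdCpow (hB x) (z / 2) *
        psdCpow (hY x) ((α / 2 : ℝ) : ℂ)))) * (psdCpow (hY x) (-(α * z)) *
        (psdCpow (hY x) ((α / 2 : ℝ) : ℂ) * psdCpow (hB x) (z / 2) * psdCpow hBs (-z / 2))) := by
      simp only [T, Matrix.mul_assoc, psdCpow_mul_assoc]
      congr 5
      push_cast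
      ring_nf
    rw [hT]
    refine (norm_trace_mul_le _ _).trans ?_
    have hL := ((frobSq_psdCpow_mul_le hX (z := α * z) (by simp [hz]) _).trans
      (frobSq_psdCpow_mul_le hBs hz3 _)).trans
      (frobSq_psdCpow_mul_le (hB x) hz2 (psdCpow (hY x) ((α / 2 : ℝ) : ℂ)))
    have hR := ((frobSq_psdCpow_mul_le (hY x) (z := -(α * z)) (by simp [hz]) _).trans
      (frobSq_mul_psdCpow_le hBs hz3 _)).trans
      (frobSq_mul_psdCpow_le (hB x) hz2 (psdCpow (hY x) ((α / 2 : ℝ) : ℂ)))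
    linarith
  have h1 : ∀ z : ℂ, z.re = 1 → ‖∑ x, (p x : ℂ) * (T x z).trace‖ ≤ q := by
    intro z hz
    set Q := psdCpow hX ((α / 2 : ℝ) : ℂ)
    set P := Q * psdCpow hX (α * (z - 1))
    have hz1 : ((z - 1) / 2).re = 0 := by simp [hz]
    have hz2 : (1 / 2 - z / 2).re = 0 := by
      rw [← sub_div]
      simp [hz]
    -- Cyclicity moves P to the far end, and B_x^{z/2} is B_x^{1/2} times an imaginary power, so
    -- each factor carries one B_x^{1/2} to average.
    have hT : ∀ x, (T x z).trace = ((Q * psdCpow hBs (-z / 2) * psdCpow (hB x) (1 / 2) *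
        psdCpow (hB x) ((z - 1) / 2) * psdCpow (hY x) (α * (1 - z))) *
        (psdCpow (hB x) ((z - 1) / 2) * (psdCpow (hB x) (1 / 2) *
          (psdCpow hBs (-z / 2) * P)))).trace := by
      intro x
      have e1 : psdCpow hX (α * z) = P * Q := by
        simp only [P, Q, psdCpow_mul]
        congr 1
        push_cast
        ring
      have e2 : (1 / 2 + (z - 1) / 2 : ℂ) = z / 2 := by ring
      have e3 : ((z - 1) / 2 + 1 / 2 : ℂ) = z / 2 := by ring
      simp only [T]
      rw [e1, Matrix.mul_assoc P Q, Matrix.trace_mul_comm P]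
      simp only [Matrix.mul_assoc, psdCpow_mul_assoc, e2, e3]
    have hterm : ∀ x, ‖(T x z).trace‖ ≤
        (frobSq ((Q * psdCpow hBs (-z / 2)) * psdCpow (hB x) (1 / 2)) +
          frobSq ((psdCpow hBs (-z / 2) * P)ᴴ * psdCpow (hB x) (1 / 2))) / 2 := by
      intro x
      rw [hT x]
      refine (norm_trace_mul_le _ _).trans ?_
      have hL := (frobSq_mul_psdCpow_le (hY x) (z := α * (1 - z)) (by simp [hz]) _).trans
        (frobSq_mul_psdCpow_le (hB x) hz1 ((Q * psdCpow hBs (-z / 2)) * psdCpow (hB x) (1 / 2)))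
      have hR := frobSq_psdCpow_mul_le (hB x) hz1
        (psdCpow (hB x) (1 / 2) * (psdCpow hBs (-z / 2) * P))
      rw [frobSq_psdCpow_half_mul] at hR
      linarith
    refine (hnorm z).trans ((Finset.sum_le_sum fun x _ =>
      mul_le_mul_of_nonneg_left (hterm x) (hp x)).trans ?_)
    -- Averaging turns B_x^{1/2} into B^{1/2}, which leaves the imaginary power B^{(1-z)/2}.
    simp only [mul_div_assoc', mul_add]
    rw [← Finset.sum_div, Finset.sum_add_distrib, sum_mul_frobSq_mul_psdCpow_half hB hBs,
      sum_mul_frobSq_mul_psdCpow_half hB hBs, ← frobSq_psdCpow_half_mul, Matrix.mul_assoc,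
      psdCpow_mul_assoc, psdCpow_mul]
    have e1 : (-z / 2 + 1 / 2 : ℂ) = 1 / 2 - z / 2 := by ring
    have e2 : (1 / 2 + -z / 2 : ℂ) = 1 / 2 - z / 2 := by ring
    rw [e1, e2]
    have hL := frobSq_mul_psdCpow_le hBs hz2 Q
    have hR := (frobSq_psdCpow_mul_le hBs hz2 P).trans
      (frobSq_mul_psdCpow_le hX (z := α * (z - 1)) (by simp [hz]) Q)
    linarith
  have hθ0 : 0 ≤ (α - 1) / α := div_nonneg (by linarith) (by linarith)
  have hθ1 : 1 - (α - 1) / α = 1 / α := by field_simp; ring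
  have hinv : 0 < 1 / α := by positivity
  have key := hF.norm_le_interp hθ0 (by linarith) h0 h1
  have hval : ∑ x, (p x : ℂ) * (T x ((α - 1) / α : ℝ)).trace = q := by
    have hne : (1 - α) / (2 * α) ≠ 0 := div_ne_zero (by linarith) (by linarith)
    have e1 : (α * ((α - 1) / α : ℝ) : ℂ) = (α : ℂ) - 1 := by push_cast; field_simp
    have e2 : (α * (1 - ((α - 1) / α : ℝ)) : ℂ) = 1 := by push_cast; field_simp; ring
    have e3 : (-((α - 1) / α : ℝ) / 2 : ℂ) = ((1 - α) / (2 * α) : ℝ) := by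
      push_cast; field_simp; ring
    have e4 : ((((α - 1) / α : ℝ) : ℂ) / 2) + ((1 - α) / (2 * α) : ℝ) = 0 := by
      push_cast; field_simp; ring
    have hTx : ∀ x, T x ((α - 1) / α : ℝ) = psdCpow hX (α - 1) *
        (psdPow (∑ x, p x • B x) ((1 - α) / (2 * α)) * A x *
          psdPow (∑ x, p x • B x) ((1 - α) / (2 * α))) := by
      intro x
      have h3 := psdCpow_mul_sandwich_mul hα (hA x) (hB x) (hker x) e4
      simp only [T]
      rw [e1, e2, e3, psdCpow_one, psdPow_eq_psdCpow hBs hne]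
      conv_rhs => rw [← h3]
      simp only [Matrix.mul_assoc]
    have hsum : ∑ x, (p x : ℂ) * (T x ((α - 1) / α : ℝ)).trace =
        (psdCpow hX (α - 1) * sandwich α (∑ x, p x • A x) (∑ x, p x • B x)).trace := by
      unfold sandwich
      simp only [hTx, Matrix.mul_sum, Matrix.sum_mul, Matrix.trace_sum,
        Matrix.mul_smul, Matrix.smul_mul, Matrix.trace_smul, real_smul]
      rfl
    have hX1 : psdCpow hX (α - 1) * sandwich α (∑ x, p x • A x) (∑ x, p x • B x) =
        psdCpow hX (α - 1) * psdCpow hX 1 := by rw [psdCpow_one]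
    rw [hsum, hX1, psdCpow_mul, sub_add_cancel, hq, ofReal_frobSq_psdCpow]
  rw [hval, norm_real, Real.norm_of_nonneg hq0, hθ1] at key
  -- Cancelling q^{(α-1)/α} requires q > 0.
  rcases hq0.eq_or_lt with hq' | hq'
  · rwa [← hq']
  · have hsplit : q = q ^ (1 / α) * q ^ ((α - 1) / α) := by
      rw [← Real.rpow_add hq', ← hθ1, sub_add_cancel, Real.rpow_one]
    nth_rw 1 [hsplit] at key
    exact (Real.rpow_le_rpow_iff hq0 hS0 hinv).1
      (le_of_mul_le_mul_right key (Real.rpow_pos_of_pos hq' _))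

lemma Dtilde_le_of_Qtilde_le {m : Type*} [Fintype m] [DecidableEq m] {α : ℝ} (hα : 1 < α)
    {A B : Matrix n n ℂ} {C D : Matrix m m ℂ} (h : Qtilde α A B ≤ Qtilde α C D) :
    Dtilde α A B ≤ Dtilde α C D := by
  unfold Dtilde log2
  refine mul_le_mul_of_nonneg_left (EReal.div_le_div_right_of_nonneg ?_
    (ENNReal.log_monotone h)) ?_
  · exact_mod_cast Real.log_nonneg one_le_two
  · exact_mod_cast (one_div_nonneg.2 (by linarith))

/-- An average does not exceed all of its terms; if some support inclusion fails, that x gives the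
value ∞. -/
lemma exists_Qtilde_sum_le {α : ℝ} (hα : 1 < α) {p : ι → ℝ} (hp : ∀ x, 0 ≤ p x)
    (hp1 : ∑ x, p x = 1) {A B : ι → Matrix n n ℂ} (hA : ∀ x, (A x).PosSemidef)
    (hB : ∀ x, (B x).PosSemidef) :
    ∃ x, Qtilde α (∑ x, p x • A x) (∑ x, p x • B x) ≤ Qtilde α (A x) (B x) := by
  by_cases hsupp : ∀ x, supp (A x) ≤ supp (B x)
  · have hker := fun x => supp_le_iff.1 (hsupp x)
    have hle := trace_sandwich_sum_le hα hp hA hB hker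
    obtain ⟨x, hx⟩ : ∃ x, (psdPow (sandwich α (∑ x, p x • A x) (∑ x, p x • B x)) α).trace.re ≤
        (psdPow (sandwich α (A x) (B x)) α).trace.re := by
      by_contra! hlt
      obtain ⟨y, -, hy⟩ : ∃ y ∈ Finset.univ, 0 < p y :=
        Finset.exists_lt_of_sum_lt (by simp [hp1])
      have := Finset.sum_lt_sum (fun x _ => mul_le_mul_of_nonneg_left (hlt x).le (hp x))
        ⟨y, Finset.mem_univ y, mul_lt_mul_of_pos_left (hlt y) hy⟩
      rw [← Finset.sum_mul, hp1, one_mul] at this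
      linarith
    refine ⟨x, ?_⟩
    unfold Qtilde
    rw [if_pos (supp_le_iff.2 (sum_smul_ker hp hB hker)), if_pos (hsupp x)]
    exact ENNReal.ofReal_le_ofReal hx
  · obtain ⟨x, hx⟩ := not_forall.1 hsupp
    refine ⟨x, ?_⟩
    conv_rhs => rw [Qtilde, if_neg hx]
    exact le_top

end JointConvexity

end SandwichedRenyi

theorem mainTheorem11 {n ι : Type*} [Fintype n] [DecidableEq n] [Fintype ι] [Nonempty ι]
    (α : ℝ) (hα : α ∈ Set.Ioc (1 : ℝ) 2)
    (p : ι → ℝ) (hp_nonneg : ∀ x, 0 ≤ p x) (hp_sum : ∑ x, p x = 1)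
    (A B : ι → Matrix n n ℂ)
    (hA : ∀ x, (A x).PosSemidef) (hB : ∀ x, (B x).PosSemidef) :
    SandwichedRenyi.Dtilde α (∑ x, p x • A x) (∑ x, p x • B x) ≤
      Finset.univ.sup' Finset.univ_nonempty
        (fun x => SandwichedRenyi.Dtilde α (A x) (B x)) := by

  obtain ⟨x, hx⟩ := SandwichedRenyi.exists_Qtilde_sum_le hα.1 hp_nonneg hp_sum hA hB
  exact (SandwichedRenyi.Dtilde_le_of_Qtilde_le hα.1 hx).trans
    (Finset.le_sup' (fun x => SandwichedRenyi.Dtilde α (A x) (B x)) (Finset.mem_univ x))
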